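/- Let $T=\{t_n\}\subset\mathbb R\setminus\{0\}$ be an infinite increasing sequence (one- or two-sided) with $|t_n|\to\infty$ as $|n|\to\infty$ which is power separated: there are $C>0$ and $N\in\mathbb N$ with $|t_{n+1}-t_n|\ge C|t_n|^{-N}$ for all $n$. Let $\mu=\sum_n\mu_n\delta_{t_n}$, $\mu_n>0$, satisfy $\int_{\mathbb R}\frac{d\mu(t)}{1+t^2}<\infty$, and let $\mathcal H(T,\mu)$ be the space of all Cauchy transforms $f(z)=\sum_n\frac{a_n\mu_n^{1/2}}{z-t_n}$ with $a=\{a_n\}\in\ell^2$. For such $f$ put $\mathcal Z_f=\{w\in\mathbb C\setminus T: f(w)=0\}\cup\{t_n\in T: a_n=0\}$. The multiplicity of a point $t_n\in\mathcal Z_f\cap T$ is one plus the order of vanishing at $t_n$ of the holomorphic extension of $f$; other zeros have their usual multiplicity. Let $D(z,r)$ be the open disc with center $z$ and radius $r$. The space $\mathcal H(T,\mu)$ has the localization property if one of the following conditions (which are equivalent for power separated $T$) holds: (i) there is an unbounded set $S\subset\mathbb C$ such that $\mathcal Z_f\cap S$ is finite for every nonzero $f\in\mathcal H(T,\mu)$;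 (ii) $\mathcal Z_f\setminus\bigcup_nD(t_n,1)$ is finite for every nonzero $f\in\mathcal H(T,\mu)$; (iii) there are pairwise disjoint discs $D(t_n,r_n)$, $r_n>0$, such that for every nonzero $f\in\mathcal H(T,\mu)$ the set $\mathcal Z_f\setminus\bigcup_nD(t_n,r_n)$ is finite and all but finitely many of the discs $D(t_n,r_n)$ contain at most one point of $\mathcal Z_f$; (iv) no nonzero $f\in\mathcal H(T,\mu)$ has infinitely many multiple zeros. **Theorem.** Let $\tilde T\subset T$ be an infinite subsequence such that the polynomials belong to $L^2(\mu|_{T\setminus\tilde T})$ but are not dense there. Suppose that there is a normal weight $\mathcal M$, that is, a positive even function $\mathcal M$ on $\mathbb R$ for which $s\mapsto-\log\mathcal M(e^s)$ is convex on $\mathbb R$, such that $\mathcal M(t_n)=\mu_n^{1/2}$ for all $n$. Then $\mathcal H(T,\mu)$ does not have the localization property, that is, none of (i)–(iv) holds. -/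

import Mathlib

open MeasureTheory Polynomial

noncomputable section

namespace CauchyLocalization

/-- `T` is the set of points of an infinite increasing sequence (one- or two-sided) with
`|t_n| → ∞` that avoids `0`: equivalently, `T` is infinite, every bounded interval contains only
finitely many of its points, and `0 ∉ T`. -/
structure IsDiscreteSequence (T : Set ℝ) : Prop where
  infinite : T.Infinite
  locallyFinite : ∀ R : ℝ, (T ∩ Set.Icc (-R) R).Finite
  zero_notMem : (0 : ℝ) ∉ T

/-- `t_{n+1} - t_n ≥ C |t_n|^{-N}` for consecutive points (hence, equivalently, for all pairs
`s < t` of points of `T`). -/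
def PowerSeparated (T : Set ℝ) : Prop :=
  ∃ C : ℝ, 0 < C ∧ ∃ N : ℕ, ∀ s ∈ T, ∀ t ∈ T, s < t → C / |s| ^ N ≤ t - s

/-- The discrete measure `μ = ∑_{t ∈ T} w(t) δ_t`. Only the values of `w` on `T` are used. -/
def discreteMeasure (T : Set ℝ) (w : ℝ → ℝ) : Measure ℝ :=
  Measure.sum fun t : T => ENNReal.ofReal (w t) • Measure.dirac (t : ℝ)

/-- The masses are positive and `∫ dμ(t) / (1 + t²) < ∞`. -/
structure IsAdmissibleWeight (T : Set ℝ) (w : ℝ → ℝ) : Prop where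
  pos : ∀ t ∈ T, 0 < w t
  integral_finite :
    ∫⁻ t, ENNReal.ofReal (1 / (1 + t ^ 2)) ∂(discreteMeasure T w) < ⊤

/-- The space `ℓ²(T)` of coefficient sequences. The map sending `a` to its Cauchy transform is
injective, and is by definition an isometry onto the space of Cauchy transforms `H(T, μ)`; so the
elements of `H(T, μ)` are represented by their coefficients. -/
abbrev Coeff (T : Set ℝ) : Type := lp (fun _ : T => ℂ) 2

/-- The element `f(z) = ∑_n a_n μ_n^{1/2} / (z - t_n)` of `H(T, μ)`; the series converges
absolutely for every `z ∉ T`. At a point `z = t ∈ T` the term with index `t` is read as `0`, so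
that if `a t = 0` the value there is that of the holomorphic extension of `f` to `t`. -/
def cauchyTransform {T : Set ℝ} (w : ℝ → ℝ) (a : Coeff T) (z : ℂ) : ℂ :=
  ∑' t : T, a t * ((√(w t) : ℝ) : ℂ) / (z - ((t : ℝ) : ℂ))

/-- The zero set `Z_f = {z ∉ T : f(z) = 0} ∪ {t_n ∈ T : a_n = 0}`. -/
def zeroSet {T : Set ℝ} (w : ℝ → ℝ) (a : Coeff T) : Set ℂ :=
  {z | (∀ t : T, z ≠ ((t : ℝ) : ℂ)) ∧ cauchyTransform w a z = 0} ∪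
    {z | ∃ t : T, z = ((t : ℝ) : ℂ) ∧ a t = 0}

/-- The points of `Z_f` of multiplicity at least two. For a point `t ∈ T` the multiplicity is that
of `A f`, where `A` has a simple zero at every point of `T`; so `t` is a multiple zero when
`a t = 0` and the holomorphic extension of `f` vanishes at `t`. -/
def multipleZeroSet {T : Set ℝ} (w : ℝ → ℝ) (a : Coeff T) : Set ℂ :=
  {z | (∀ t : T, z ≠ ((t : ℝ) : ℂ)) ∧ cauchyTransform w a z = 0 ∧
      deriv (cauchyTransform w a) z = 0} ∪
    {z | ∃ t : T, z = ((t : ℝ) : ℂ) ∧ a t = 0 ∧ cauchyTransform w a z = 0}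

/-- There is an unbounded set that contains only finitely many zeros of every nonzero `f`. -/
def LocalizedOffUnboundedSet (T : Set ℝ) (w : ℝ → ℝ) : Prop :=
  ∃ S : Set ℂ, ¬ Bornology.IsBounded S ∧
    ∀ a : Coeff T, a ≠ 0 → (zeroSet w a ∩ S).Finite

/-- Every nonzero `f` has only finitely many zeros outside `⋃ D(t_n, 1)`. -/
def LocalizedNearUnitDisks (T : Set ℝ) (w : ℝ → ℝ) : Prop :=
  ∀ a : Coeff T, a ≠ 0 →
    (zeroSet w a \ ⋃ t : T, Metric.ball ((t : ℝ) : ℂ) 1).Finite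

/-- There are disjoint disks `D(t_n, r_n)` such that every nonzero `f` has only finitely many zeros
outside their union, and all but finitely many of the disks contain at most one zero of `f`. -/
def LocalizedInDisjointDisks (T : Set ℝ) (w : ℝ → ℝ) : Prop :=
  ∃ r : T → ℝ, (∀ t, 0 < r t) ∧
    (Pairwise fun s t : T =>
      Disjoint (Metric.ball ((s : ℝ) : ℂ) (r s)) (Metric.ball ((t : ℝ) : ℂ) (r t))) ∧
    ∀ a : Coeff T, a ≠ 0 →
      (zeroSet w a \ ⋃ t : T, Metric.ball ((t : ℝ) : ℂ) (r t)).Finite ∧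
      {t : T | ¬ (zeroSet w a ∩ Metric.ball ((t : ℝ) : ℂ) (r t)).Subsingleton}.Finite

/-- No nonzero `f` has infinitely many multiple zeros. -/
def FinitelyManyMultipleZeros (T : Set ℝ) (w : ℝ → ℝ) : Prop :=
  ∀ a : Coeff T, a ≠ 0 → (multipleZeroSet w a).Finite

/-- The localization property of `H(T, μ)`: one of the four conditions above holds (they are
equivalent when `T` is power separated). -/
def HasLocalizationProperty (T : Set ℝ) (w : ℝ → ℝ) : Prop :=
  LocalizedOffUnboundedSet T w ∨ LocalizedNearUnitDisks T w ∨
    LocalizedInDisjointDisks T w ∨ FinitelyManyMultipleZeros T w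

/-- The polynomials belong to `L²(ν)`. -/
def PolynomialsInL2 (ν : Measure ℝ) : Prop :=
  ∀ p : ℂ[X], MemLp (fun x : ℝ => p.eval (x : ℂ)) 2 ν

/-- The (classes of) polynomials are dense in `L²(ν)`. -/
def PolynomialsDenseInL2 (ν : Measure ℝ) : Prop :=
  Dense {g : Lp ℂ 2 ν | ∃ p : ℂ[X], (g : ℝ → ℂ) =ᵐ[ν] fun x : ℝ => p.eval (x : ℂ)}

/-- `M` is a normal weight: a positive even function such that `-log M(e^s)` is a convex function
of `s`. -/
structure IsNormalWeight (M : ℝ → ℝ) : Prop where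
  pos : ∀ x, 0 < M x
  even : ∀ x, M (-x) = M x
  convex : ConvexOn ℝ Set.univ fun s : ℝ => -Real.log (M (Real.exp s))

end CauchyLocalization

end

namespace CauchyLocalization

/-! Zeros of a very flat function can be moved, one at a time and at small cost, into any prescribed
unbounded set S. A nonzero element of L²(μ|_{T∖T'}) orthogonal to the polynomials gives coefficients
a that vanish on T' and for which ∑ a_t μ_t^{1/2} δ_t has zero moments
(`exists_isFlat_zero_of_not_dense`). Hence z^k f(z) = ∑ a_t μ_t^{1/2} t^k / (z - t) for every k.

Every s ∈ T' with a_s = 0 counts as a zero. Multiplying f by (1 - z/ζ)/(1 - z/s) moves it to ζ and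
preserves the zero moments; the only danger is the new coefficient at s, a multiple of
f(s)/μ_s^{1/2}. Here the normal weight enters: a supporting line of the convex function -log M(e^u)
at u = log|s| yields a k for which M(t)|t/s|^k is bounded by M(s) up to controlled powers of |t| and
|s|. So f(s) is O(μ_s^{1/2}) times a negative power of |s|
(`HasZeroMoments.exists_norm_transform_le`), and the move costs O(1/|s|) in ℓ¹, uniformly in |ζ| >
|s| (`HasZeroMoments.exists_hasSum_relocate_sub_le`).

Since T' is infinite, s can be taken as far out as needed. Infinitely many moves with summable costs
converge to a nonzero f with infinitely many zeros in S (`exists_infinite_setOf_vanishesAt`). Taking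
S to be the complement of the discs, or S = T', where a zero moved onto an existing one becomes
double, refutes each form of localization. -/

/-! ### Discrete and power separated sequences -/

theorem IsDiscreteSequence.exists_gap {T : Set ℝ} (hT : IsDiscreteSequence T) (z : ℂ) :
    ∃ δ : ℝ, 0 < δ ∧ ∀ t ∈ T, (t : ℂ) ≠ z → δ ≤ ‖z - t‖ := by
  set F : Set ℂ := ((fun t : ℝ => (t : ℂ)) '' (T ∩ Set.Icc (-(‖z‖ + 1)) (‖z‖ + 1))) \ {z} with hF
  have hfin : F.Finite := ((hT.locallyFinite _).image _).subset Set.sdiff_subset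
  have hz : z ∈ Fᶜ := by simp [hF]
  obtain ⟨ε, hε, hball⟩ := Metric.isOpen_iff.1 hfin.isClosed.isOpen_compl z hz
  refine ⟨min ε 1, by positivity, fun t ht htz => ?_⟩
  by_cases h : |t| ≤ ‖z‖ + 1
  · have : (t : ℂ) ∉ Metric.ball z ε := fun hb =>
      hball hb ⟨⟨t, ⟨ht, abs_le.1 h⟩, rfl⟩, htz⟩
    rw [Metric.mem_ball, dist_comm, dist_eq_norm, not_lt] at this
    exact (min_le_left _ _).trans this
  · have h1 : ‖(t : ℂ)‖ - ‖z‖ ≤ ‖(t : ℂ) - z‖ := norm_sub_norm_le _ _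
    rw [Complex.norm_real, Real.norm_eq_abs, norm_sub_rev] at h1
    exact (min_le_right _ _).trans (by linarith [not_le.1 h])

theorem IsDiscreteSequence.exists_one_add_abs_le {T : Set ℝ} (hT : IsDiscreteSequence T) (z : ℂ) :
    ∃ D : ℝ, 0 < D ∧ ∀ t ∈ T, (t : ℂ) ≠ z → 1 + |t| ≤ D * ‖z - t‖ := by
  obtain ⟨δ, hδ, h⟩ := hT.exists_gap z
  refine ⟨(1 + ‖z‖) / δ + 1, by positivity, fun t ht htz => ?_⟩
  have h1 : ‖(t : ℂ)‖ - ‖z‖ ≤ ‖(t : ℂ) - z‖ := norm_sub_norm_le _ _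
  rw [Complex.norm_real, Real.norm_eq_abs, norm_sub_rev] at h1
  have h2 : (1 + ‖z‖) ≤ (1 + ‖z‖) / δ * ‖z - t‖ := by
    rw [div_mul_eq_mul_div, le_div_iff₀ hδ]
    exact mul_le_mul_of_nonneg_left (h t ht htz) (by positivity)
  linarith

theorem IsDiscreteSequence.exists_pos_le_abs {T : Set ℝ} (hT : IsDiscreteSequence T) :
    ∃ δ : ℝ, 0 < δ ∧ ∀ t ∈ T, δ ≤ |t| := by
  obtain ⟨δ, hδ, h⟩ := hT.exists_gap 0
  refine ⟨δ, hδ, fun t ht => ?_⟩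
  have := h t ht (by
    intro h0
    rw [Complex.ofReal_eq_zero] at h0
    exact hT.zero_notMem (h0 ▸ ht))
  simpa using this

theorem IsDiscreteSequence.exists_lt_abs {T T' : Set ℝ} (hT : IsDiscreteSequence T) (hT' : T' ⊆ T)
    (hinf : T'.Infinite) (R : ℝ) : ∃ t ∈ T', R < |t| := by
  by_contra! h
  exact hinf ((hT.locallyFinite R).subset fun t ht => ⟨hT' ht, abs_le.1 (h t ht)⟩)

theorem PowerSeparated.exists_one_le_mul {T : Set ℝ} (hT : IsDiscreteSequence T)
    (hsep : PowerSeparated T) :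
    ∃ C : ℝ, 0 < C ∧ ∃ N : ℕ, ∀ s ∈ T, ∀ t ∈ T, s ≠ t → 1 ≤ C * |s| ^ N * |s - t| := by
  obtain ⟨C, hC, N, hN⟩ := hsep
  obtain ⟨δ, hδ, hTδ⟩ := hT.exists_pos_le_abs
  refine ⟨2 ^ N / C + 1 / δ ^ (N + 1), by positivity, N, fun s hs t ht hst => ?_⟩
  have hs0 := hTδ s hs
  have hspos : 0 < |s| := hδ.trans_le hs0
  have htpos : 0 < |t| := hδ.trans_le (hTδ t ht)
  have hpow : 0 < |s| ^ N * |s - t| := by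
    have : 0 < |s - t| := abs_pos.2 (sub_ne_zero.2 hst)
    positivity
  -- Either |t| is comparable to |s| and separation from the smaller point suffices, or t is so
  -- large that |s - t| ≥ |s| ≥ δ.
  have key : 1 ≤ 2 ^ N / C * (|s| ^ N * |s - t|) ∨ 1 ≤ 1 / δ ^ (N + 1) * (|s| ^ N * |s - t|) := by
    by_cases h : |t| ≤ 2 * |s|
    · left
      have h1 : C / (2 * |s|) ^ N ≤ |s - t| := by
        rcases lt_or_gt_of_ne hst with h2 | h2
        · rw [abs_sub_comm, abs_of_pos (sub_pos.2 h2)]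
          refine le_trans ?_ (hN s hs t ht h2)
          gcongr
          linarith
        · rw [abs_of_pos (sub_pos.2 h2)]
          refine le_trans ?_ (hN t ht s hs h2)
          gcongr
      rw [div_le_iff₀ (by positivity), mul_pow] at h1
      rw [div_mul_eq_mul_div, le_div_iff₀ hC]
      linarith
    · right
      have h1 : |s| ≤ |s - t| := by
        have := abs_sub_abs_le_abs_sub t s
        rw [abs_sub_comm] at this
        linarith
      rw [div_mul_eq_mul_div, le_div_iff₀ (by positivity), one_mul, one_mul, pow_succ]
      gcongr
      exact hs0.trans h1
  have e1 : 0 < 2 ^ N / C * (|s| ^ N * |s - t|) := by positivity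
  have e2 : 0 < 1 / δ ^ (N + 1) * (|s| ^ N * |s - t|) := by positivity
  rw [mul_assoc, add_mul]
  rcases key with h | h <;> linarith

/-- The substitution ψ(t) = t|t|^N turns power separation into uniform separation, so ⌊ψ(t)/c⌋
embeds T in ℤ and the sum is compared with ∑ 1/(1 + n²). -/
theorem PowerSeparated.exists_summable_one_div_abs_pow {T : Set ℝ} (hT : IsDiscreteSequence T)
    (hsep : PowerSeparated T) : ∃ p : ℕ, Summable fun t : T => 1 / |(t : ℝ)| ^ p := by
  obtain ⟨C, hC, N, hN⟩ := hsep
  obtain ⟨δ, hδ, hTδ⟩ := hT.exists_pos_le_abs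
  set c : ℝ := min C (δ ^ (N + 1)) with hc
  have hcpos : 0 < c := by positivity
  set ψ : ℝ → ℝ := fun t => t * |t| ^ N with hψ
  have habs : ∀ t, |ψ t| = |t| ^ (N + 1) := fun t => by
    simp only [hψ, abs_mul, abs_pow, abs_abs]
    ring
  have hψsep : ∀ s ∈ T, ∀ t ∈ T, s < t → ψ s + c ≤ ψ t := by
    intro s hs t ht hst
    have hspos : 0 < |s| := hδ.trans_le (hTδ s hs)
    have htpos : 0 < |t| := hδ.trans_le (hTδ t ht)
    have h1 : C ≤ (t - s) * |s| ^ N := (div_le_iff₀ (by positivity)).1 (hN s hs t ht hst)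
    have h2 : c ≤ C := min_le_left _ _
    rcases lt_or_gt_of_ne (abs_pos.1 htpos) with h | h
    · have h3 : |t| ^ N ≤ |s| ^ N := by
        gcongr 1
        rw [abs_of_neg h, abs_of_neg (hst.trans h)]
        linarith
      have := mul_le_mul_of_nonpos_left h3 h.le
      simp only [hψ]
      linarith
    · rcases lt_or_gt_of_ne (abs_pos.1 hspos) with h' | h'
      · have h3 : c ≤ ψ t := by
          have h4 : 0 ≤ ψ t := by positivity
          rw [← abs_of_nonneg h4, habs]
          exact (min_le_right _ _).trans (pow_le_pow_left₀ hδ.le (hTδ t ht) _)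
        have h5 : ψ s ≤ 0 := mul_nonpos_of_nonpos_of_nonneg h'.le (by positivity)
        linarith
      · have h3 : |s| ^ N ≤ |t| ^ N := by
          gcongr 1
          rw [abs_of_pos h, abs_of_pos h']
          exact hst.le
        have := mul_le_mul_of_nonneg_left h3 h.le
        simp only [hψ]
        linarith
  set e : T → ℤ := fun t => ⌊ψ t / c⌋ with he
  have he_lt : ∀ s t : T, (s : ℝ) < t → e s < e t := by
    intro s t hst
    rw [← Int.add_one_le_iff, Int.le_floor]
    push_cast
    have h1 : (⌊ψ s / c⌋ : ℝ) ≤ ψ s / c := Int.floor_le _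
    have h2 : ψ s / c + 1 ≤ ψ t / c := by
      rw [div_add_one hcpos.ne']
      exact div_le_div_of_nonneg_right (hψsep s s.2 t t.2 hst) hcpos.le
    exact (add_le_add_left h1 1).trans h2
  have hinj : Function.Injective e := by
    intro s t hst
    by_contra hne
    rcases lt_or_gt_of_ne (fun h => hne (Subtype.ext h)) with h | h
    · exact (he_lt s t h).ne hst
    · exact (he_lt t s h).ne' hst
  have hsum : Summable fun n : ℤ => 1 / (1 + (n : ℝ) ^ 2) := by
    refine Summable.of_norm_bounded_eventually (Real.summable_one_div_int_pow.2 one_lt_two) ?_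
    rw [Filter.eventually_cofinite]
    refine (Set.finite_singleton (0 : ℤ)).subset fun n hn => ?_
    by_contra h0
    apply hn
    have : 0 < (n : ℝ) ^ 2 := by
      have : (n : ℝ) ≠ 0 := by exact_mod_cast h0
      positivity
    rw [Real.norm_of_nonneg (by positivity)]
    gcongr
    linarith
  refine ⟨2 * (N + 1), Summable.of_nonneg_of_le (fun t => by positivity) (fun t => ?_)
    ((hsum.comp_injective hinj).mul_left (5 / c ^ 2))⟩
  have htpos : 0 < |(t : ℝ)| := hδ.trans_le (hTδ t t.2)
  have h1 : 1 ≤ |ψ t| / c := by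
    rw [one_le_div hcpos, habs]
    exact (min_le_right _ _).trans (pow_le_pow_left₀ hδ.le (hTδ t t.2) _)
  have h2 : |(e t : ℝ)| ≤ 2 * (|ψ t| / c) := by
    have h3 : |ψ t / c| = |ψ t| / c := by rw [abs_div, abs_of_pos hcpos]
    have h4 := Int.floor_le (ψ t / c)
    have h5 := Int.lt_floor_add_one (ψ t / c)
    have h6 := abs_le.1 h3.le
    rw [abs_le]
    constructor <;> simp only [he] <;> linarith
  have h3 : (e t : ℝ) ^ 2 ≤ (2 * (|ψ t| / c)) ^ 2 := by
    rw [← sq_abs]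
    gcongr
  have h4 : 1 ≤ (|ψ t| / c) ^ 2 := one_le_pow₀ h1
  have h5 : 1 + (e t : ℝ) ^ 2 ≤ 5 / c ^ 2 * |(t : ℝ)| ^ (2 * (N + 1)) := by
    have : 5 / c ^ 2 * |(t : ℝ)| ^ (2 * (N + 1)) = 5 * (|ψ t| / c) ^ 2 := by
      rw [habs, div_pow, ← pow_mul, mul_comm 2]
      ring
    rw [this]
    nlinarith
  simp only [Function.comp_def]
  rw [mul_one_div, div_le_div_iff₀ (by positivity) (by positivity), one_mul]
  exact h5

theorem IsAdmissibleWeight.summable {T : Set ℝ} {w : ℝ → ℝ} (hw : IsAdmissibleWeight T w) :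
    Summable fun t : T => w t / (1 + (t : ℝ) ^ 2) := by
  have h := hw.integral_finite
  rw [discreteMeasure, lintegral_sum_measure] at h
  simp only [lintegral_smul_measure, lintegral_dirac, smul_eq_mul] at h
  have h2 := ENNReal.summable_toReal h.ne
  refine h2.congr fun t => ?_
  rw [ENNReal.toReal_mul, ENNReal.toReal_ofReal (hw.pos t t.2).le,
    ENNReal.toReal_ofReal (by positivity)]
  ring

/-! ### Cauchy transforms and vanishing moments -/

/-- The Cauchy transform of an arbitrary family of coefficients. -/
noncomputable def transform {T : Set ℝ} (w : ℝ → ℝ) (a : T → ℂ) (z : ℂ) : ℂ :=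
  ∑' t : T, a t * ((√(w t) : ℝ) : ℂ) / (z - ((t : ℝ) : ℂ))

theorem summable_transform {T : Set ℝ} (hT : IsDiscreteSequence T) {w : ℝ → ℝ} {a : T → ℂ}
    (ha : Summable fun t : T => a t * ((√(w t) : ℝ) : ℂ)) (z : ℂ) :
    Summable fun t : T => a t * ((√(w t) : ℝ) : ℂ) / (z - ((t : ℝ) : ℂ)) := by
  obtain ⟨D, hD, h⟩ := hT.exists_one_add_abs_le z
  refine Summable.of_norm_bounded (ha.norm.mul_left D) fun t => ?_
  by_cases htz : ((t : ℝ) : ℂ) = z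
  · simp only [htz, sub_self, div_zero, norm_zero]
    positivity
  · have h1 := h t t.2 htz
    have h2 : 0 < ‖z - ((t : ℝ) : ℂ)‖ := norm_pos_iff.2 (sub_ne_zero.2 (Ne.symm htz))
    rw [norm_div, div_le_iff₀ h2, mul_right_comm]
    refine le_mul_of_one_le_left (norm_nonneg _) ?_
    linarith [abs_nonneg (t : ℝ)]

/-- All moments of the measure `∑ a_t μ_t^{1/2} δ_t` vanish. -/
def HasZeroMoments {T : Set ℝ} (w : ℝ → ℝ) (a : T → ℂ) : Prop :=
  ∀ k : ℕ, HasSum (fun t : T => a t * ((√(w t) : ℝ) : ℂ) * ((t : ℝ) : ℂ) ^ k) 0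

theorem HasZeroMoments.summable {T : Set ℝ} {w : ℝ → ℝ} {a : T → ℂ} (ha : HasZeroMoments w a) :
    Summable fun t : T => a t * ((√(w t) : ℝ) : ℂ) := by
  simpa using (ha 0).summable

/-- Since t^{k+1}/(z - t) = z t^k/(z - t) - t^k, each vanishing moment allows one more factor z to
be pulled out. The freedom to choose k is what makes f small on T'. -/
theorem HasZeroMoments.hasSum_transform {T : Set ℝ} (hT : IsDiscreteSequence T) {w : ℝ → ℝ}
    {a : T → ℂ} (ha : HasZeroMoments w a) {z : ℂ} (hz : ∀ t : T, ((t : ℝ) : ℂ) = z → a t = 0)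
    (k : ℕ) :
    HasSum (fun t : T => a t * ((√(w t) : ℝ) : ℂ) * ((t : ℝ) : ℂ) ^ k / (z - ((t : ℝ) : ℂ)))
      (z ^ k * transform w a z) := by
  induction k with
  | zero => simpa [transform] using (summable_transform hT ha.summable z).hasSum
  | succ k ih =>
    have h := (ih.mul_left z).sub (ha k)
    rw [sub_zero, ← mul_assoc, ← pow_succ'] at h
    refine h.congr_fun fun t => ?_
    by_cases htz : ((t : ℝ) : ℂ) = z
    · simp [hz t htz]
    · have : z - ((t : ℝ) : ℂ) ≠ 0 := sub_ne_zero.2 (Ne.symm htz)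
      field_simp
      ring

/-! ### Moving a zero -/

/-- The coefficients of `(A + B / (s - z)) f(z)`, where `f` is the Cauchy transform of `a` and
`a s = 0`. -/
noncomputable def relocate {T : Set ℝ} (w : ℝ → ℝ) (A B : ℂ) (s : T) (a : T → ℂ) : T → ℂ := by
  classical
  exact fun t => a t * (A + B / (((s : ℝ) : ℂ) - ((t : ℝ) : ℂ))) +
    if t = s then -B * transform w a ((s : ℝ) : ℂ) / ((√(w s) : ℝ) : ℂ) else 0

theorem relocate_of_ne {T : Set ℝ} (w : ℝ → ℝ) (A B : ℂ) {s t : T} (a : T → ℂ) (h : t ≠ s) :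
    relocate w A B s a t = a t * (A + B / (((s : ℝ) : ℂ) - ((t : ℝ) : ℂ))) := by
  simp [relocate, h]

theorem relocate_self {T : Set ℝ} (w : ℝ → ℝ) (A B : ℂ) {s : T} {a : T → ℂ} (h : a s = 0) :
    relocate w A B s a s = -B * transform w a ((s : ℝ) : ℂ) / ((√(w s) : ℝ) : ℂ) := by
  simp [relocate, h]

/-- The test family g serves two purposes: powers t^k give the moments of the new family, and 1/(z -
t) gives its transform. -/
theorem hasSum_relocate {T : Set ℝ} {w : ℝ → ℝ} {A B : ℂ} {s : T} {a : T → ℂ}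
    (hws : 0 < w s) (g : T → ℂ) {x y : ℂ}
    (hx : HasSum (fun t : T => a t * ((√(w t) : ℝ) : ℂ) * g t) x)
    (hy : HasSum (fun t : T => a t * ((√(w t) : ℝ) : ℂ) * g t / (((s : ℝ) : ℂ) - ((t : ℝ) : ℂ))) y) :
    HasSum (fun t : T => relocate w A B s a t * ((√(w t) : ℝ) : ℂ) * g t)
      (A * x + B * y - B * transform w a ((s : ℝ) : ℂ) * g s) := by
  classical
  have hne : ((√(w s) : ℝ) : ℂ) ≠ 0 := by
    exact_mod_cast (Real.sqrt_pos.2 hws).ne'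
  have h := ((hx.mul_left A).add (hy.mul_left B)).add
    (hasSum_ite_eq s (-(B * transform w a ((s : ℝ) : ℂ) * g s)))
  rw [← sub_eq_add_neg] at h
  refine h.congr_fun fun t => ?_
  by_cases hts : t = s
  · subst hts
    simp only [relocate, if_true]
    field_simp
  · simp only [relocate, hts, if_false, add_zero]
    ring

theorem HasZeroMoments.relocate {T : Set ℝ} (hT : IsDiscreteSequence T) {w : ℝ → ℝ}
    {a : T → ℂ} (ha : HasZeroMoments w a) (A B : ℂ) {s : T} (hws : 0 < w s) (has : a s = 0) :
    HasZeroMoments w (relocate w A B s a) := by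
  intro k
  have h := hasSum_relocate (A := A) (B := B) hws (fun t : T => ((t : ℝ) : ℂ) ^ k) (ha k)
    (ha.hasSum_transform hT (z := ((s : ℝ) : ℂ)) (by
      intro t ht
      rw [Complex.ofReal_inj, Subtype.coe_inj] at ht
      rw [ht, has]) k)
  convert h using 1
  ring

theorem transform_relocate {T : Set ℝ} (hT : IsDiscreteSequence T) {w : ℝ → ℝ}
    {a : T → ℂ} (ha : HasZeroMoments w a) (A B : ℂ) {s : T} (hws : 0 < w s) (has : a s = 0)
    {z : ℂ} (hzs : z ≠ ((s : ℝ) : ℂ)) (hz : ∀ t : T, ((t : ℝ) : ℂ) = z → a t = 0) :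
    transform w (relocate w A B s a) z =
      (A + B / (((s : ℝ) : ℂ) - z)) * transform w a z := by
  have hs0 : ((s : ℝ) : ℂ) - z ≠ 0 := sub_ne_zero.2 hzs.symm
  have hz0 : z - ((s : ℝ) : ℂ) ≠ 0 := sub_ne_zero.2 hzs
  have hx := (summable_transform hT ha.summable z).hasSum
  have hy := (summable_transform hT ha.summable ((s : ℝ) : ℂ)).hasSum
  have h := hasSum_relocate (A := A) (B := B) hws (fun t : T => (z - ((t : ℝ) : ℂ))⁻¹)
    (x := transform w a z)
    -- Partial fractions: 1/((z - t)(s - t)) = (1/(z - t) - 1/(s - t))/(s - z).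
    (y := (transform w a z - transform w a ((s : ℝ) : ℂ)) / (((s : ℝ) : ℂ) - z)) (by
      simpa only [transform, div_eq_mul_inv] using hx) (by
      refine HasSum.congr_fun ((hx.sub hy).div_const (((s : ℝ) : ℂ) - z)) fun t => ?_
      by_cases hat : a t = 0
      · simp [hat]
      · have h1 : z - ((t : ℝ) : ℂ) ≠ 0 := sub_ne_zero.2 fun h => hat (hz t h.symm)
        have h2 : ((s : ℝ) : ℂ) - ((t : ℝ) : ℂ) ≠ 0 := sub_ne_zero.2 fun h => hat (by
          rw [Complex.ofReal_inj, Subtype.coe_inj] at h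
          rw [← h, has])
        field_simp
        ring)
  simp only [← div_eq_mul_inv] at h
  rw [transform, HasSum.tsum_eq h]
  field_simp
  ring

/-! ### Normal weights -/

theorem exists_supporting_slope {φ : ℝ → ℝ} (hφ : ConvexOn ℝ Set.univ φ) (u : ℝ) :
    ∃ σ : ℝ, ∀ v, φ u + σ * (v - u) ≤ φ v := by
  refine ⟨derivWithin φ (Set.Ioi u) u, fun v => ?_⟩
  have hu : u ∈ interior (Set.univ : Set ℝ) := by simp
  rcases lt_trichotomy u v with h | h | h
  · have h1 := hφ.rightDeriv_le_slope_of_mem_interior hu (Set.mem_univ v) h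
    rw [slope_def_field, le_div_iff₀ (sub_pos.2 h)] at h1
    linarith
  · simp [h]
  · have h1 := (hφ.slope_le_leftDeriv_of_mem_interior (Set.mem_univ v) hu h).trans
      (hφ.leftDeriv_le_rightDeriv_of_mem_interior hu)
    rw [slope_def_field, div_le_iff₀ (sub_pos.2 h)] at h1
    linarith

theorem IsNormalWeight.apply_eq_exp {M : ℝ → ℝ} (hM : IsNormalWeight M) {x : ℝ} (hx : x ≠ 0) :
    M x = Real.exp (-(-Real.log (M (Real.exp (Real.log |x|))))) := by
  rw [neg_neg, Real.exp_log (hM.pos _), Real.exp_log (abs_pos.2 hx)]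
  rcases abs_choice x with h | h <;> rw [h]
  exact (hM.even x).symm

/-- A supporting line of slope σ at log|t| says M(x) ≤ M(t)|x/t|^{-σ}. Rounding σ down to an integer
costs at most the factor max(1, |t/x|). The pair x₀, y₀ where M decreases forces σ > 0, so the
rounded exponent is a natural number. -/
theorem IsNormalWeight.exists_pow_le {M : ℝ → ℝ} (hM : IsNormalWeight M) {x₀ y₀ : ℝ}
    (hx₀ : 0 < |x₀|) (hxy : |x₀| < |y₀|) (hMxy : M y₀ < M x₀) (J : ℕ) {t : ℝ} (ht : |y₀| ≤ |t|) :
    ∃ k : ℕ, ∀ x : ℝ, x ≠ 0 → M x * |x / t| ^ k ≤ M t * |x / t| ^ J * (1 + |t / x|) := by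
  have hy₀ : 0 < |y₀| := hx₀.trans hxy
  have ht0 : 0 < |t| := hy₀.trans_le ht
  set φ : ℝ → ℝ := fun s : ℝ => -Real.log (M (Real.exp s)) with hφ
  have happ : ∀ x : ℝ, x ≠ 0 → M x = Real.exp (-φ (Real.log |x|)) := fun x hx =>
    hM.apply_eq_exp hx
  have h0 : φ (Real.log |x₀|) < φ (Real.log |y₀|) := by
    rw [happ _ (abs_pos.1 hx₀), happ _ (abs_pos.1 hy₀), Real.exp_lt_exp] at hMxy
    linarith
  have h1 : Real.log |x₀| < Real.log |y₀| := Real.log_lt_log hx₀ hxy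
  have h2 : Real.log |y₀| ≤ Real.log |t| := Real.log_le_log hy₀ ht
  obtain ⟨σ₀, hσ₀⟩ := exists_supporting_slope hM.convex (Real.log |y₀|)
  obtain ⟨σ, hσ⟩ := exists_supporting_slope hM.convex (Real.log |t|)
  change ∀ v, φ _ + _ ≤ φ v at hσ₀ hσ
  have hσ₀pos : 0 < σ₀ := by
    have := hσ₀ (Real.log |x₀|)
    by_contra! hneg
    nlinarith
  have hσpos : 0 < σ := by
    have h3 := hσ₀ (Real.log |t|)
    have h4 := hσ (Real.log |x₀|)
    have h5 := mul_nonneg hσ₀pos.le (sub_nonneg.2 h2)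
    by_contra! hneg
    nlinarith
  refine ⟨⌊σ⌋₊ + J, fun x hx => ?_⟩
  have hx0 : 0 < |x| := abs_pos.2 hx
  set d := Real.log |x| - Real.log |t| with hd
  have hxt : |x / t| = Real.exp d := by
    rw [abs_div, hd, Real.exp_sub, Real.exp_log hx0, Real.exp_log ht0]
  have htx : |t / x| = Real.exp (-d) := by
    rw [abs_div, hd, neg_sub, Real.exp_sub, Real.exp_log hx0, Real.exp_log ht0]
  rw [hxt, htx, pow_add, ← mul_assoc, mul_right_comm _ (Real.exp d ^ J)]
  refine mul_le_mul_of_nonneg_right ?_ (by positivity)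
  rw [happ x hx, happ t (abs_pos.1 ht0), ← Real.exp_nat_mul, ← Real.exp_add]
  have h3 := hσ (Real.log |x|)
  have h4 : (⌊σ⌋₊ : ℝ) ≤ σ := Nat.floor_le hσpos.le
  have h5 : σ < (⌊σ⌋₊ : ℝ) + 1 := Nat.lt_floor_add_one σ
  have h6 : -φ (Real.log |x|) + ⌊σ⌋₊ * d ≤ -φ (Real.log |t|) + max 0 (-d) := by
    rcases le_total 0 d with h | h
    · have := mul_le_mul_of_nonneg_right h4 h
      linarith [le_max_left 0 (-d)]
    · have : (⌊σ⌋₊ - σ) * d ≤ -d := by nlinarith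
      linarith [le_max_right 0 (-d)]
  refine (Real.exp_le_exp.2 h6).trans ?_
  rw [Real.exp_add]
  refine mul_le_mul_of_nonneg_left ?_ (Real.exp_pos _).le
  rcases max_choice 0 (-d) with h | h <;> rw [h]
  · rw [Real.exp_zero]
    linarith [Real.exp_pos (-d)]
  · linarith

/-! ### Flat families of coefficients -/

/-- Families of coefficients with vanishing moments that decay like `|t|^{-j}` and have finite
support in `T'`. -/
structure IsFlat {T : Set ℝ} (T' : Set ℝ) (w : ℝ → ℝ) (j : ℕ) (a : T → ℂ) : Prop where
  bounded : ∃ C : ℝ, ∀ t : T, ‖a t‖ * |(t : ℝ)| ^ j ≤ C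
  vanish : ∃ R : ℝ, ∀ t : T, (t : ℝ) ∈ T' → R ≤ |(t : ℝ)| → a t = 0
  moments : HasZeroMoments w a

theorem IsFlat.relocate_of_bounded {T T' : Set ℝ} {w : ℝ → ℝ} {i j : ℕ} {a : T → ℂ}
    (hT : IsDiscreteSequence T) (ha : IsFlat T' w i a) {A B : ℂ} {s : T}
    (hws : 0 < w s) (has : a s = 0) {C : ℝ}
    (hC : ∀ t : T, t ≠ s → ‖a t * (A + B / (((s : ℝ) : ℂ) - ((t : ℝ) : ℂ)))‖ * |(t : ℝ)| ^ j ≤ C) :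
    IsFlat T' w j (relocate w A B s a) := by
  obtain ⟨R, hR⟩ := ha.vanish
  refine ⟨⟨max C (‖relocate w A B s a s‖ * |(s : ℝ)| ^ j), fun t => ?_⟩,
    ⟨max R (|(s : ℝ)| + 1), fun t ht htR => ?_⟩, ha.moments.relocate hT A B hws has⟩
  · by_cases hts : t = s
    · rw [hts]
      exact le_max_right _ _
    · rw [relocate_of_ne w A B a hts]
      exact (hC t hts).trans (le_max_left _ _)
  · have hts : t ≠ s := by
      rintro rfl
      linarith [le_max_right R (|(t : ℝ)| + 1)]
    rw [relocate_of_ne w A B a hts, hR t ht ((le_max_left _ _).trans htR), zero_mul]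

theorem IsDiscreteSequence.exists_one_add_abs_le_of_mem {T : Set ℝ} (hT : IsDiscreteSequence T)
    (s : T) : ∃ D : ℝ, 0 < D ∧ ∀ t : T, t ≠ s →
      (1 + |(t : ℝ)|) / ‖((s : ℝ) : ℂ) - ((t : ℝ) : ℂ)‖ ≤ D := by
  obtain ⟨D, hD, h⟩ := hT.exists_one_add_abs_le ((s : ℝ) : ℂ)
  refine ⟨D, hD, fun t hts => ?_⟩
  have hne : ((t : ℝ) : ℂ) ≠ ((s : ℝ) : ℂ) := by
    rwa [Ne, Complex.ofReal_inj, Subtype.coe_inj]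
  rw [div_le_iff₀ (norm_pos_iff.2 (sub_ne_zero.2 hne.symm))]
  exact h t t.2 hne

theorem IsFlat.relocate {T T' : Set ℝ} {w : ℝ → ℝ} {j : ℕ} {a : T → ℂ}
    (hT : IsDiscreteSequence T) (ha : IsFlat T' w j a) (A B : ℂ) {s : T}
    (hws : 0 < w s) (has : a s = 0) : IsFlat T' w j (relocate w A B s a) := by
  obtain ⟨D, hD, h⟩ := hT.exists_one_add_abs_le_of_mem s
  obtain ⟨C, hC⟩ := ha.bounded
  refine ha.relocate_of_bounded hT hws has (C := C * (‖A‖ + ‖B‖ * D)) fun t hts => ?_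
  rw [norm_mul, mul_right_comm]
  refine mul_le_mul (hC t) ((norm_add_le _ _).trans ?_) (norm_nonneg _)
    ((by positivity : (0 : ℝ) ≤ ‖a t‖ * |(t : ℝ)| ^ j).trans (hC t))
  rw [norm_div, div_eq_mul_inv]
  gcongr
  refine le_trans ?_ (h t hts)
  rw [← one_div]
  gcongr
  linarith [abs_nonneg (t : ℝ)]

/-- With A = 0 the function is divided by s - z, which gains one power of decay at the price of the
zero s. -/
theorem IsFlat.relocate_zero {T T' : Set ℝ} {w : ℝ → ℝ} {j : ℕ} {a : T → ℂ}
    (hT : IsDiscreteSequence T) (ha : IsFlat T' w j a) (B : ℂ) {s : T}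
    (hws : 0 < w s) (has : a s = 0) :
    IsFlat T' w (j + 1) (CauchyLocalization.relocate w 0 B s a) := by
  obtain ⟨D, hD, h⟩ := hT.exists_one_add_abs_le_of_mem s
  obtain ⟨C, hC⟩ := ha.bounded
  refine ha.relocate_of_bounded hT hws has (C := C * (‖B‖ * D)) fun t hts => ?_
  rw [norm_mul, pow_succ, zero_add, norm_div]
  have h1 : ‖B‖ / ‖((s : ℝ) : ℂ) - ((t : ℝ) : ℂ)‖ * |(t : ℝ)| ≤ ‖B‖ * D := by
    rw [div_mul_eq_mul_div, mul_div_assoc]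
    gcongr
    refine le_trans ?_ (h t hts)
    gcongr
    linarith
  calc ‖a t‖ * (‖B‖ / ‖((s : ℝ) : ℂ) - ((t : ℝ) : ℂ)‖) * (|(t : ℝ)| ^ j * |(t : ℝ)|)
      = ‖a t‖ * |(t : ℝ)| ^ j * (‖B‖ / ‖((s : ℝ) : ℂ) - ((t : ℝ) : ℂ)‖ * |(t : ℝ)|) := by ring
    _ ≤ C * (‖B‖ * D) := mul_le_mul (hC t) h1 (by positivity)
        ((by positivity : (0 : ℝ) ≤ ‖a t‖ * |(t : ℝ)| ^ j).trans (hC t))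

/-- Infinitely many zeros on T' are available, so one can be divided out for each power of decay
required. -/
theorem IsFlat.exists_ne_zero {T T' : Set ℝ} {w : ℝ → ℝ} (hT : IsDiscreteSequence T)
    (hw : ∀ t ∈ T, 0 < w t) (hT' : T' ⊆ T) (hinf : T'.Infinite)
    (h : ∃ a : T → ℂ, a ≠ 0 ∧ IsFlat T' w 0 a) (j : ℕ) :
    ∃ a : T → ℂ, a ≠ 0 ∧ IsFlat T' w j a := by
  induction j with
  | zero => exact h
  | succ j ih =>
    obtain ⟨a, ha0, ha⟩ := ih
    obtain ⟨R, hR⟩ := ha.vanish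
    obtain ⟨s, hs, hRs⟩ := hT.exists_lt_abs hT' hinf R
    have has : a ⟨s, hT' hs⟩ = 0 := hR ⟨s, hT' hs⟩ hs hRs.le
    refine ⟨_, fun h0 => ha0 ?_, ha.relocate_zero hT 1 (hw s (hT' hs)) has⟩
    ext t
    by_cases hts : t = ⟨s, hT' hs⟩
    · rw [hts, has]
      rfl
    · have h1 := congrFun h0 t
      rw [relocate_of_ne w 0 1 a hts, zero_add, Pi.zero_apply, mul_eq_zero] at h1
      refine h1.resolve_right (one_div_ne_zero (sub_ne_zero.2 fun h => hts ?_))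
      rw [Complex.ofReal_inj] at h
      exact Subtype.ext h.symm

theorem IsFlat.summable {T T' : Set ℝ} {w : ℝ → ℝ} {p q : ℕ} {a : T → ℂ}
    (hT : IsDiscreteSequence T) (hp : Summable fun t : T => 1 / |(t : ℝ)| ^ p)
    (ha : IsFlat T' w (q + p) a) : Summable fun t : T => ‖a t‖ * |(t : ℝ)| ^ q := by
  obtain ⟨C, hC⟩ := ha.bounded
  refine Summable.of_nonneg_of_le (fun t => by positivity) (fun t => ?_) (hp.mul_left C)
  have : 0 < |(t : ℝ)| := abs_pos.2 fun h => hT.zero_notMem (h ▸ t.2)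
  rw [mul_one_div, le_div_iff₀ (by positivity), mul_assoc, ← pow_add]
  exact hC t

/-! ### The cost of moving a zero -/

theorem HasZeroMoments.exists_norm_transform_le {T : Set ℝ} {w : ℝ → ℝ} {M : ℝ → ℝ}
    (hT : IsDiscreteSequence T) (hM : IsNormalWeight M) (hMT : ∀ t ∈ T, M t = √(w t))
    (hdec : ∃ x y : ℝ, 0 < |x| ∧ |x| < |y| ∧ M y < M x)
    {C₁ : ℝ} (hC₁ : 0 < C₁) {N : ℕ}
    (hsep : ∀ s ∈ T, ∀ t ∈ T, s ≠ t → 1 ≤ C₁ * |s| ^ N * |s - t|) {a : T → ℂ}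
    (ha : HasZeroMoments w a) (J : ℕ) (hsum : Summable fun t : T => ‖a t‖ * |(t : ℝ)| ^ (J + N)) :
    ∃ C R : ℝ, 0 < C ∧ ∀ t : T, R ≤ |(t : ℝ)| → a t = 0 →
      ‖transform w a ((t : ℝ) : ℂ)‖ * |(t : ℝ)| ^ J ≤ C * √(w t) * |(t : ℝ)| := by
  obtain ⟨x₀, y₀, hx₀, hxy, hMxy⟩ := hdec
  obtain ⟨δ, hδ, hTδ⟩ := hT.exists_pos_le_abs
  set S₀ := ∑' t : T, ‖a t‖ * |(t : ℝ)| ^ (J + N) with hS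
  have hS0 : 0 ≤ S₀ := tsum_nonneg fun t => by positivity
  refine ⟨2 * C₁ / δ * (S₀ + 1), |y₀|, by positivity, fun t ht hat => ?_⟩
  -- The exponent k varies with t, but the resulting constants do not.
  obtain ⟨k, hk⟩ := hM.exists_pow_le hx₀ hxy hMxy J ht
  have htpos : 0 < |(t : ℝ)| := (hx₀.trans hxy).trans_le ht
  have ht0 : ((t : ℝ) : ℂ) ≠ 0 := by exact_mod_cast abs_pos.1 htpos
  have h1 := (ha.hasSum_transform hT (z := ((t : ℝ) : ℂ)) (fun s hs => by
    rw [Complex.ofReal_inj, Subtype.coe_inj] at hs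
    rw [hs, hat]) k).div_const (((t : ℝ) : ℂ) ^ k)
  rw [mul_div_cancel_left₀ _ (pow_ne_zero k ht0)] at h1
  have h2 := hsum.hasSum.mul_left (2 * C₁ / δ * √(w t) * |(t : ℝ)| / |(t : ℝ)| ^ J)
  have h3 := tsum_of_norm_bounded h2 (f := fun s : T =>
    a s * ((√(w s) : ℝ) : ℂ) * ((s : ℝ) : ℂ) ^ k / (((t : ℝ) : ℂ) - ((s : ℝ) : ℂ)) /
      ((t : ℝ) : ℂ) ^ k) (fun s => ?_)
  · rw [h1.tsum_eq, ← hS, div_mul_eq_mul_div, le_div_iff₀ (by positivity)] at h3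
    refine h3.trans ?_
    have h4 : 0 ≤ 2 * C₁ / δ * √(w t) * |(t : ℝ)| := by positivity
    nlinarith
  · have hspos : 0 < |(s : ℝ)| := hδ.trans_le (hTδ s s.2)
    by_cases hst : s = t
    · rw [hst, hat]
      simp only [zero_mul, zero_div, norm_zero]
      positivity
    have hne : (s : ℝ) ≠ t := fun h => hst (Subtype.ext h)
    have hd : 0 < |(s : ℝ) - t| := abs_pos.2 (sub_ne_zero.2 hne)
    have hdiff : ‖((t : ℝ) : ℂ) - ((s : ℝ) : ℂ)‖ = |(s : ℝ) - t| := by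
      rw [← Complex.ofReal_sub, Complex.norm_real, Real.norm_eq_abs, abs_sub_comm]
    have hs := hsep s s.2 t t.2 hne
    have hks := hk s (abs_pos.1 hspos)
    rw [hMT s s.2, hMT t t.2, abs_div, abs_div, div_pow, div_pow] at hks
    have hfac : 1 + |(t : ℝ)| / |(s : ℝ)| ≤ 2 / δ * |(t : ℝ)| := by
      have e1 : 1 ≤ |(t : ℝ)| / δ := (one_le_div hδ).2 (hTδ t t.2)
      have e2 : |(t : ℝ)| / |(s : ℝ)| ≤ |(t : ℝ)| / δ := by
        gcongr
        exact hTδ s s.2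
      have e3 : 2 / δ * |(t : ℝ)| = |(t : ℝ)| / δ + |(t : ℝ)| / δ := by ring
      linarith
    have hinv : 1 / |(s : ℝ) - t| ≤ C₁ * |(s : ℝ)| ^ N := (div_le_iff₀ hd).2 hs
    have hsqrt : ‖((√(w s) : ℝ) : ℂ)‖ = √(w s) := by
      rw [Complex.norm_real, Real.norm_of_nonneg (Real.sqrt_nonneg _)]
    simp only [norm_div, norm_mul, norm_pow, hdiff, hsqrt, Complex.norm_real, Real.norm_eq_abs]
    calc ‖a s‖ * √(w s) * |(s : ℝ)| ^ k / |(s : ℝ) - t| / |(t : ℝ)| ^ k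
        = ‖a s‖ * (√(w s) * (|(s : ℝ)| ^ k / |(t : ℝ)| ^ k)) * (1 / |(s : ℝ) - t|) := by ring
      _ ≤ ‖a s‖ * (√(w t) * (|(s : ℝ)| ^ J / |(t : ℝ)| ^ J) * (2 / δ * |(t : ℝ)|)) *
          (C₁ * |(s : ℝ)| ^ N) := by
        refine mul_le_mul (mul_le_mul_of_nonneg_left (hks.trans ?_) (norm_nonneg _)) hinv
          (by positivity) (by positivity)
        gcongr
      _ = 2 * C₁ / δ * √(w t) * |(t : ℝ)| / |(t : ℝ)| ^ J *
          (‖a s‖ * |(s : ℝ)| ^ (J + N)) := by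
        rw [pow_add]
        ring

/-- Moving the zero `s` of `f` to `ζ` changes the coefficients by `O(1 / |s|)` in `ℓ¹`. -/
theorem HasZeroMoments.exists_hasSum_relocate_sub_le {T : Set ℝ} {w : ℝ → ℝ} {M : ℝ → ℝ}
    (hT : IsDiscreteSequence T) (hw : ∀ t ∈ T, 0 < w t)
    (hM : IsNormalWeight M) (hMT : ∀ t ∈ T, M t = √(w t))
    (hdec : ∃ x y : ℝ, 0 < |x| ∧ |x| < |y| ∧ M y < M x)
    {C₁ : ℝ} (hC₁ : 0 < C₁) {N : ℕ}
    (hsep : ∀ s ∈ T, ∀ t ∈ T, s ≠ t → 1 ≤ C₁ * |s| ^ N * |s - t|) {a : T → ℂ}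
    (ha : HasZeroMoments w a) (hsum : Summable fun t : T => ‖a t‖ * |(t : ℝ)| ^ (3 + N)) :
    ∃ C R : ℝ, ∀ s : T, R ≤ |(s : ℝ)| → a s = 0 → ∀ ζ : ℂ, |(s : ℝ)| < ‖ζ‖ →
      ∃ b : T → ℝ, ∃ x ≤ C / |(s : ℝ)|, HasSum b x ∧ ∀ t : T,
        ‖CauchyLocalization.relocate w (((s : ℝ) : ℂ) / ζ) (((s : ℝ) : ℂ) * (1 - ((s : ℝ) : ℂ) / ζ)) s a t - a t‖
          ≤ b t := by
  classical
  obtain ⟨δ, hδ, hTδ⟩ := hT.exists_pos_le_abs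
  obtain ⟨C₂, R, hC₂, h₂⟩ := ha.exists_norm_transform_le hT hM hMT hdec hC₁ hsep 3 hsum
  set D := 2 * (1 / δ ^ (2 + N) + C₁ / δ) with hD
  refine ⟨D * (∑' t : T, ‖a t‖ * |(t : ℝ)| ^ (3 + N)) + 2 * C₂, R, fun s hs has ζ hζ =>
    ⟨fun t => D / |(s : ℝ)| * (‖a t‖ * |(t : ℝ)| ^ (3 + N)) +
      if t = s then 2 * C₂ / |(s : ℝ)| else 0, _, le_of_eq ?_,
      (hsum.hasSum.mul_left _).add (hasSum_ite_eq s _), fun t => ?_⟩⟩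
  · ring
  have hspos : 0 < |(s : ℝ)| := hδ.trans_le (hTδ s s.2)
  have hs0 : ((s : ℝ) : ℂ) ≠ 0 := by exact_mod_cast abs_pos.1 hspos
  have hnorm : ∀ t : ℝ, ‖(t : ℂ)‖ = |t| := fun t => by rw [Complex.norm_real, Real.norm_eq_abs]
  -- The parameters A = s/ζ and B = s(1 - s/ζ) make the multiplier (1 - z/ζ)/(1 - z/s), so |B| ≤
  -- 2|s|. Two powers of |s| are lost at the index s, and the exponent 3 leaves O(1/|s|).
  have hfac : ‖1 - ((s : ℝ) : ℂ) / ζ‖ ≤ 2 := by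
    have h1 : ‖((s : ℝ) : ℂ) / ζ‖ ≤ 1 := by
      rw [norm_div, hnorm]
      exact div_le_one_of_le₀ hζ.le (norm_nonneg _)
    have := norm_sub_le (1 : ℂ) (((s : ℝ) : ℂ) / ζ)
    rw [norm_one] at this
    linarith
  have htpos : 0 < |(t : ℝ)| := hδ.trans_le (hTδ t t.2)
  by_cases hts : t = s
  · subst hts
    beta_reduce
    rw [relocate_self w _ _ has, has, sub_zero, norm_zero, zero_mul, mul_zero, zero_add, if_pos rfl]
    have hw0 : 0 < √(w t) := Real.sqrt_pos.2 (hw t t.2)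
    rw [norm_div, norm_mul, norm_neg, norm_mul, hnorm, hnorm, abs_of_pos hw0, div_le_div_iff₀ hw0 hspos]
    have h3 := h₂ t hs has
    calc |(t : ℝ)| * ‖1 - ((t : ℝ) : ℂ) / ζ‖ * ‖transform w a ((t : ℝ) : ℂ)‖ * |(t : ℝ)|
        ≤ |(t : ℝ)| * 2 * ‖transform w a ((t : ℝ) : ℂ)‖ * |(t : ℝ)| := by gcongr
      _ = 2 * (‖transform w a ((t : ℝ) : ℂ)‖ * |(t : ℝ)| ^ 3) / |(t : ℝ)| := by
        field_simp
      _ ≤ 2 * (C₂ * √(w t) * |(t : ℝ)|) / |(t : ℝ)| := by gcongr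
      _ = 2 * C₂ * √(w t) := by field_simp
  · have hne : (t : ℝ) ≠ s := fun h => hts (Subtype.ext h)
    have hd : 0 < |(t : ℝ) - s| := abs_pos.2 (sub_ne_zero.2 hne)
    have hd0 : ((s : ℝ) : ℂ) - ((t : ℝ) : ℂ) ≠ 0 := by
      rw [sub_ne_zero, Ne, Complex.ofReal_inj]
      exact hne.symm
    have hdiff : ‖((s : ℝ) : ℂ) - ((t : ℝ) : ℂ)‖ = |(t : ℝ) - s| := by
      rw [← Complex.ofReal_sub, hnorm, abs_sub_comm]
    beta_reduce
    rw [relocate_of_ne w _ _ a hts, if_neg hts, add_zero]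
    -- The multiplier differs from 1 by (1 - s/ζ) t/(s - t), which is O(1/|s|) for fixed t.
    have heq : a t * (((s : ℝ) : ℂ) / ζ + ((s : ℝ) : ℂ) * (1 - ((s : ℝ) : ℂ) / ζ) /
        (((s : ℝ) : ℂ) - ((t : ℝ) : ℂ))) - a t =
        a t * ((1 - ((s : ℝ) : ℂ) / ζ) * (((t : ℝ) : ℂ) / (((s : ℝ) : ℂ) - ((t : ℝ) : ℂ)))) := by
      generalize ((s : ℝ) : ℂ) / ζ = q
      field_simp
      ring
    rw [heq, norm_mul, norm_mul, norm_div, hdiff, hnorm]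
    have h1 : |(s : ℝ)| ≤ |(t : ℝ)| + |(t : ℝ) - s| := by
      have := abs_sub_abs_le_abs_sub (s : ℝ) t
      rw [abs_sub_comm] at this
      linarith
    have hinv : 1 / |(t : ℝ) - s| ≤ C₁ * |(t : ℝ)| ^ N :=
      (div_le_iff₀ hd).2 (hsep t t.2 s s.2 hne)
    have h2 : |(s : ℝ)| / |(t : ℝ) - s| ≤ 1 + |(t : ℝ)| * (C₁ * |(t : ℝ)| ^ N) := by
      calc |(s : ℝ)| / |(t : ℝ) - s| ≤ (|(t : ℝ)| + |(t : ℝ) - s|) / |(t : ℝ) - s| := by gcongr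
        _ = 1 + |(t : ℝ)| * (1 / |(t : ℝ) - s|) := by field_simp; ring
        _ ≤ _ := by gcongr
    have h3 : 1 ≤ 1 / δ ^ (2 + N) * |(t : ℝ)| ^ (2 + N) := by
      rw [div_mul_eq_mul_div, one_mul, one_le_div (by positivity)]
      exact pow_le_pow_left₀ hδ.le (hTδ t t.2) _
    have h4 : 1 ≤ 1 / δ * |(t : ℝ)| := by
      rw [div_mul_eq_mul_div, one_mul, one_le_div hδ]
      exact hTδ t t.2
    have h5 : 1 + |(t : ℝ)| * (C₁ * |(t : ℝ)| ^ N) ≤ D / 2 * |(t : ℝ)| ^ (2 + N) := by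
      have : |(t : ℝ)| * (C₁ * |(t : ℝ)| ^ N) ≤
          |(t : ℝ)| * (C₁ * |(t : ℝ)| ^ N) * (1 / δ * |(t : ℝ)|) :=
        le_mul_of_one_le_right (by positivity) h4
      have e : D / 2 * |(t : ℝ)| ^ (2 + N) = 1 / δ ^ (2 + N) * |(t : ℝ)| ^ (2 + N) +
          |(t : ℝ)| * (C₁ * |(t : ℝ)| ^ N) * (1 / δ * |(t : ℝ)|) := by
        rw [hD]
        ring
      linarith
    calc ‖a t‖ * (‖1 - ((s : ℝ) : ℂ) / ζ‖ * (|(t : ℝ)| / |(t : ℝ) - s|))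
        ≤ ‖a t‖ * (2 * (|(t : ℝ)| / |(t : ℝ) - s|)) := by gcongr
      _ = ‖a t‖ * (2 * |(t : ℝ)|) / |(s : ℝ)| * (|(s : ℝ)| / |(t : ℝ) - s|) := by field_simp
      _ ≤ ‖a t‖ * (2 * |(t : ℝ)|) / |(s : ℝ)| * (D / 2 * |(t : ℝ)| ^ (2 + N)) := by
        gcongr
        exact h2.trans h5
      _ = D / |(s : ℝ)| * (‖a t‖ * |(t : ℝ)| ^ (3 + N)) := by ring

/-! ### From failure of density to a flat family -/

theorem IsDiscreteSequence.countable {T : Set ℝ} (hT : IsDiscreteSequence T) : T.Countable := by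
  refine (Set.countable_iUnion fun n : ℕ => (hT.locallyFinite n).countable).mono fun t ht => ?_
  obtain ⟨n, hn⟩ := exists_nat_ge |t|
  exact Set.mem_iUnion.2 ⟨n, ht, abs_le.1 hn⟩

theorem hasSum_setIntegral_discreteMeasure {T : Set ℝ} {w : ℝ → ℝ} (hw : ∀ t ∈ T, 0 < w t)
    {s : Set ℝ} (hs : MeasurableSet s) {f : ℝ → ℂ}
    (hf : Integrable f ((discreteMeasure T w).restrict s)) :
    HasSum (fun t : T => s.indicator f t * ((w t : ℝ) : ℂ))
      (∫ x in s, f x ∂(discreteMeasure T w)) := by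
  rw [← integral_indicator hs]
  have hf' : Integrable (s.indicator f) (discreteMeasure T w) := (integrable_indicator_iff hs).2 hf
  refine (hasSum_integral_measure hf').congr_fun fun t => ?_
  rw [integral_smul_measure, integral_dirac, ENNReal.toReal_ofReal (hw t t.2).le, Complex.real_smul,
    mul_comm]

theorem exists_isFlat_zero_of_not_dense {T T' : Set ℝ} {w : ℝ → ℝ} (hT : IsDiscreteSequence T)
    (hw : ∀ t ∈ T, 0 < w t)
    (hmem : PolynomialsInL2 ((discreteMeasure T w).restrict (T \ T')))
    (hnotdense : ¬ PolynomialsDenseInL2 ((discreteMeasure T w).restrict (T \ T'))) :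
    ∃ a : T → ℂ, a ≠ 0 ∧ (∀ t : T, (t : ℝ) ∈ T' → a t = 0) ∧ IsFlat T' w 0 a := by
  have hmeas : MeasurableSet (T \ T') :=
    (hT.countable.mono Set.sdiff_subset).measurableSet
  set ν := (discreteMeasure T w).restrict (T \ T') with hν
  let P : ℂ[X] →ₗ[ℂ] Lp ℂ 2 ν :=
    { toFun := fun p => (hmem p).toLp
      map_add' := fun p q => by
        rw [← MemLp.toLp_add]
        congr 1
        ext x
        simp
      map_smul' := fun c p => by
        rw [RingHom.id_apply, ← MemLp.toLp_const_smul]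
        congr 1
        ext x
        simp }
  have hP : ∀ p : ℂ[X], (P p : ℝ → ℂ) =ᵐ[ν] fun x : ℝ => p.eval (x : ℂ) := fun p =>
    (hmem p).coeFn_toLp
  -- In a Hilbert space a subspace that is not dense has a nonzero orthogonal vector.
  have hbot : (LinearMap.range P)ᗮ ≠ ⊥ := by
    intro h
    rw [← Submodule.topologicalClosure_eq_top_iff,
      ← Submodule.dense_iff_topologicalClosure_eq_top] at h
    refine hnotdense (h.mono ?_)
    rintro _ ⟨p, rfl⟩
    exact ⟨p, hP p⟩
  obtain ⟨g, hg, hg0⟩ := Submodule.exists_mem_ne_zero_of_ne_bot hbot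
  have hsq : ∀ t : T, ((√(w t) : ℝ) : ℂ) * ((√(w t) : ℝ) : ℂ) = ((w t : ℝ) : ℂ) := fun t => by
    rw [← Complex.ofReal_mul, Real.mul_self_sqrt (hw t t.2).le]
  have hgg := hasSum_setIntegral_discreteMeasure hw hmeas (L2.integrable_inner (𝕜 := ℂ) g g)
  set a : T → ℂ := fun t => (T \ T').indicator (g : ℝ → ℂ) t * ((√(w t) : ℝ) : ℂ) with ha
  have hnorm : ∀ t : T, ‖(T \ T').indicator (fun x => inner ℂ ((g : ℝ → ℂ) x) ((g : ℝ → ℂ) x)) t *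
      ((w t : ℝ) : ℂ)‖ = ‖a t‖ ^ 2 := by
    intro t
    rw [← hsq, ha]
    by_cases ht : (t : ℝ) ∈ T \ T'
    · rw [Set.indicator_of_mem ht]
      simp only [Set.indicator_of_mem ht, norm_mul, RCLike.inner_apply, RCLike.norm_conj]
      ring
    · rw [Set.indicator_of_notMem ht]
      simp [Set.indicator_of_notMem ht]
  refine ⟨a, fun h0 => hg0 ?_, fun t ht => ?_, ⟨?_, ⟨0, fun t ht _ => ?_⟩, fun k => ?_⟩⟩
  · rw [← inner_self_eq_zero (𝕜 := ℂ), L2.inner_def]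
    refine hgg.unique (hasSum_zero.congr_fun fun t => ?_)
    rw [← norm_eq_zero, hnorm, h0]
    simp
  · simp [ha, Set.indicator_of_notMem (fun h : (t : ℝ) ∈ T \ T' => h.2 ht)]
  · refine ⟨1 + ∑' t : T, ‖a t‖ ^ 2, fun t => ?_⟩
    have h1 : Summable fun t : T => ‖a t‖ ^ 2 := hgg.summable.norm.congr hnorm
    have h2 := h1.le_tsum t fun _ _ => by positivity
    rw [pow_zero, mul_one]
    nlinarith [sq_nonneg (‖a t‖ - 1)]
  · simp [ha, Set.indicator_of_notMem (fun h : (t : ℝ) ∈ T \ T' => h.2 ht)]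
  · have hk0 : inner ℂ (P (X ^ k)) g = 0 :=
      (Submodule.mem_orthogonal _ _).1 hg _ (LinearMap.mem_range_self P _)
    have hae : (fun x => inner ℂ ((P (X ^ k) : ℝ → ℂ) x) ((g : ℝ → ℂ) x)) =ᵐ[ν]
        fun x => (g : ℝ → ℂ) x * (x : ℂ) ^ k := by
      filter_upwards [hP (X ^ k)] with x hx
      rw [hx, RCLike.inner_apply]
      simp
    rw [L2.inner_def, integral_congr_ae hae] at hk0
    have h1 := hasSum_setIntegral_discreteMeasure hw hmeas
      ((L2.integrable_inner (𝕜 := ℂ) (P (X ^ k)) g).congr hae)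
    rw [hk0] at h1
    refine h1.congr_fun fun t => ?_
    rw [← hsq, ha]
    by_cases ht : (t : ℝ) ∈ T \ T'
    · simp only [Set.indicator_of_mem ht]
      ring
    · simp [Set.indicator_of_notMem ht]

theorem HasZeroMoments.infinite_support {T : Set ℝ} {w : ℝ → ℝ} (hw : ∀ t ∈ T, 0 < w t)
    {a : T → ℂ} (ha : HasZeroMoments w a) (ha0 : a ≠ 0) : (Function.support a).Infinite := by
  classical
  intro hfin
  obtain ⟨t₀, ht₀⟩ := Function.ne_iff.1 ha0
  -- If the support were finite, p would vanish on all of it except t₀, and integrating p would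
  -- isolate the term at t₀.
  set p : ℂ[X] := ∏ s ∈ hfin.toFinset.erase t₀, (X - C ((s : ℝ) : ℂ)) with hp
  have h1 : HasSum (fun t : T => a t * ((√(w t) : ℝ) : ℂ) * p.eval ((t : ℝ) : ℂ)) 0 := by
    have h2 := hasSum_sum (s := Finset.range (p.natDegree + 1))
      fun i _ => (ha i).mul_left (p.coeff i)
    simp only [mul_zero, Finset.sum_const_zero] at h2
    refine h2.congr_fun fun t => ?_
    rw [eval_eq_sum_range, Finset.mul_sum]
    exact Finset.sum_congr rfl fun i _ => by ring
  have h2 := hasSum_single (f := fun t : T => a t * ((√(w t) : ℝ) : ℂ) * p.eval ((t : ℝ) : ℂ)) t₀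
    (fun t ht => by
      by_cases hat : a t = 0
      · simp [hat]
      · have : p.eval ((t : ℝ) : ℂ) = 0 := by
          rw [hp, eval_prod]
          exact Finset.prod_eq_zero (Finset.mem_erase.2 ⟨ht, hfin.mem_toFinset.2 hat⟩) (by simp)
        rw [this, mul_zero])
  have h3 := h2.unique h1
  have h4 : ((√(w t₀) : ℝ) : ℂ) ≠ 0 := by
    exact_mod_cast (Real.sqrt_pos.2 (hw t₀ t₀.2)).ne'
  have h5 : p.eval ((t₀ : ℝ) : ℂ) ≠ 0 := by
    rw [hp, eval_prod, Finset.prod_ne_zero_iff]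
    intro s hs
    rw [eval_sub, eval_X, eval_C, sub_ne_zero, Ne, Complex.ofReal_inj, Subtype.coe_inj]
    exact (Finset.mem_erase.1 hs).1.symm
  exact mul_ne_zero (mul_ne_zero ht₀ h4) h5 h3

/-- Constants are square integrable on T∖T', so the masses tend to 0 along this infinite set and M
must decrease somewhere. -/
theorem exists_normalWeight_lt {T T' : Set ℝ} {w : ℝ → ℝ} {M : ℝ → ℝ} (hT : IsDiscreteSequence T)
    (hw : ∀ t ∈ T, 0 < w t) (hMT : ∀ t ∈ T, M t = √(w t))
    (hmem : PolynomialsInL2 ((discreteMeasure T w).restrict (T \ T')))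
    (hinf : (T \ T').Infinite) : ∃ x y : ℝ, 0 < |x| ∧ |x| < |y| ∧ M y < M x := by
  obtain ⟨x, hx⟩ := hinf.nonempty
  have hmeas : MeasurableSet (T \ T') :=
    (hT.countable.mono Set.sdiff_subset).measurableSet
  have hint : Integrable (fun _ : ℝ => (1 : ℂ)) ((discreteMeasure T w).restrict (T \ T')) := by
    have h1 := hmem 1
    simp only [eval_one] at h1
    rw [memLp_const_iff (by simp) (by simp)] at h1
    rw [integrable_const_iff_isFiniteMeasure one_ne_zero]
    exact ⟨h1.resolve_left one_ne_zero⟩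
  have hsum := (hasSum_setIntegral_discreteMeasure hw hmeas hint).summable
  have hlim := hsum.tendsto_cofinite_zero.norm
  rw [norm_zero] at hlim
  have hev := hlim.eventually_lt_const (hw x hx.1)
  rw [Filter.eventually_cofinite] at hev
  have hfin := (hev.image ((↑) : T → ℝ)).union (hT.locallyFinite |x|)
  obtain ⟨y, hy, hyn⟩ := (hinf.sdiff hfin).nonempty
  rw [Set.mem_union, not_or] at hyn
  refine ⟨x, y, abs_pos.2 fun h => hT.zero_notMem (h ▸ hx.1), ?_, ?_⟩
  · by_contra! h
    exact hyn.2 ⟨hy.1, abs_le.1 h⟩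
  · rw [hMT y hy.1, hMT x hx.1]
    refine Real.sqrt_lt_sqrt (hw y hy.1).le ?_
    by_contra h
    refine hyn.1 ⟨⟨y, hy.1⟩, ?_, rfl⟩
    rw [Set.mem_ofPred_eq, Set.indicator_of_mem hy, one_mul, Complex.norm_real,
      Real.norm_of_nonneg (hw y hy.1).le]
    exact h

/-! ### Continuity in ℓ² -/

theorem exists_coeff_norm_le {T : Set ℝ} {x : T → ℂ} {b : T → ℝ} {c : ℝ} (hb : HasSum b c)
    (hx : ∀ t, ‖x t‖ ≤ b t) : ∃ y : Coeff T, (∀ t, y t = x t) ∧ ‖y‖ ≤ c := by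
  have hb0 : ∀ t, 0 ≤ b t := fun t => (norm_nonneg _).trans (hx t)
  have hc : 0 ≤ c := hb.nonneg hb0
  -- An ℓ¹ majorant of sum c bounds each entry by c, hence the sum of squares by c².
  have hle : ∀ t, ‖x t‖ ^ (2 : ENNReal).toReal ≤ b t * c := fun t => by
    rw [ENNReal.toReal_ofNat, Real.rpow_two, sq]
    exact mul_le_mul (hx t) ((hx t).trans (le_hasSum hb t fun i _ => hb0 i)) (norm_nonneg _) (hb0 t)
  have hs : Summable fun t => ‖x t‖ ^ (2 : ENNReal).toReal :=
    Summable.of_nonneg_of_le (fun t => by positivity) hle (hb.mul_right c).summable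
  refine ⟨⟨x, memℓp_gen hs⟩, fun t => rfl, lp.norm_le_of_tsum_le (by simp) hc ?_⟩
  rw [ENNReal.toReal_ofNat, Real.rpow_two, sq]
  have := hs.tsum_le_of_sum_le fun F => (Finset.sum_le_sum fun t _ => hle t).trans
    (sum_le_hasSum F (fun t _ => mul_nonneg (hb0 t) hc) (hb.mul_right c))
  simpa using this

/-- Evaluation at z is the inner product with the vector of conjugates of μ_t^{1/2}/(z - t), which
lies in ℓ² because ∑ μ_t/(1 + t²) converges. -/
theorem continuous_transform {T : Set ℝ} {w : ℝ → ℝ} (hT : IsDiscreteSequence T)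
    (hw : IsAdmissibleWeight T w) (z : ℂ) : Continuous fun a : Coeff T => transform w a z := by
  obtain ⟨D, hD, h⟩ := hT.exists_one_add_abs_le z
  have hmem : Memℓp (fun t : T => starRingEnd ℂ (((√(w t) : ℝ) : ℂ) / (z - ((t : ℝ) : ℂ)))) 2 := by
    refine memℓp_gen (Summable.of_nonneg_of_le (fun t => by positivity) (fun t => ?_)
      (hw.summable.mul_left (D ^ 2)))
    have hw0 := (hw.pos t t.2).le
    rw [ENNReal.toReal_ofNat, Real.rpow_two, RCLike.norm_conj, norm_div, Complex.norm_real,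
      Real.norm_of_nonneg (Real.sqrt_nonneg _), div_pow, Real.sq_sqrt hw0]
    by_cases htz : ((t : ℝ) : ℂ) = z
    · simp only [htz, sub_self, norm_zero, ne_eq, OfNat.ofNat_ne_zero, not_false_eq_true, zero_pow,
        div_zero]
      positivity
    · have h2 : 0 < ‖z - ((t : ℝ) : ℂ)‖ := norm_pos_iff.2 (sub_ne_zero.2 (Ne.symm htz))
      rw [mul_div_assoc', div_le_div_iff₀ (by positivity) (by positivity), mul_comm (D ^ 2), mul_assoc,
        ← mul_pow]
      refine mul_le_mul_of_nonneg_left (le_trans ?_ (pow_le_pow_left₀ (by positivity) (h t t.2 htz) 2))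
        hw0
      nlinarith [sq_abs (t : ℝ), abs_nonneg (t : ℝ)]
  have heq : ∀ a : Coeff T, inner ℂ (⟨_, hmem⟩ : Coeff T) a = transform w a z := fun a => by
    rw [transform, ← (lp.hasSum_inner (⟨_, hmem⟩ : Coeff T) a).tsum_eq]
    refine tsum_congr fun t => ?_
    rw [RCLike.inner_apply, Complex.conj_conj, mul_div_assoc]
  simp only [← heq]
  exact continuous_const.inner continuous_id

theorem continuous_coeff_apply {T : Set ℝ} (t : T) : Continuous fun a : Coeff T => a t :=
  (continuous_apply t).comp lp.uniformContinuous_coe.continuous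

/-! ### Prescribed zeros -/

/-- `z` is a zero of the Cauchy transform of `a`, and it is a multiple one if it lies in `T'`. -/
def VanishesAt {T : Set ℝ} (T' : Set ℝ) (w : ℝ → ℝ) (a : T → ℂ) (z : ℂ) : Prop :=
  (∀ t : T, ((t : ℝ) : ℂ) = z → a t = 0) ∧
    ((∀ t : T, ((t : ℝ) : ℂ) = z → (t : ℝ) ∈ T') → transform w a z = 0)

/-- This lets zeros created at finite stages survive in the ℓ² limit. -/
theorem isClosed_setOf_vanishesAt {T : Set ℝ} (T' : Set ℝ) {w : ℝ → ℝ} (hT : IsDiscreteSequence T)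
    (hw : IsAdmissibleWeight T w) (z : ℂ) : IsClosed {a : Coeff T | VanishesAt T' w a z} := by
  simp only [VanishesAt, Set.ofPred_and, Set.ofPred_forall]
  exact (isClosed_iInter fun t => isClosed_iInter fun _ =>
    isClosed_eq (continuous_coeff_apply t) continuous_const).inter
    (isClosed_iInter fun _ => isClosed_eq (continuous_transform hT hw z) continuous_const)

theorem VanishesAt.relocate {T T' : Set ℝ} {w : ℝ → ℝ} (hT : IsDiscreteSequence T) {a : T → ℂ}
    (ha : HasZeroMoments w a) (A B : ℂ) {s : T} (hws : 0 < w s) (has : a s = 0) {z : ℂ}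
    (hzs : z ≠ ((s : ℝ) : ℂ)) (hz : VanishesAt T' w a z) :
    VanishesAt T' w (relocate w A B s a) z := by
  refine ⟨fun t ht => ?_, fun h => ?_⟩
  · have hts : t ≠ s := by
      rintro rfl
      exact hzs ht.symm
    rw [relocate_of_ne w A B a hts, hz.1 t ht, zero_mul]
  · rw [transform_relocate hT ha A B hws has hzs hz.1, hz.2 h, mul_zero]

theorem vanishesAt_relocate {T T' : Set ℝ} {w : ℝ → ℝ} (hT : IsDiscreteSequence T) {a : T → ℂ}
    (ha : HasZeroMoments w a) {s : T} (hws : 0 < w s) (has : a s = 0) {ζ : ℂ} (hζ : ζ ≠ 0)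
    (hζs : ζ ≠ ((s : ℝ) : ℂ)) (h : ∀ t : T, ((t : ℝ) : ℂ) = ζ → (t : ℝ) ∈ T' → a t = 0) :
    VanishesAt T' w
      (relocate w (((s : ℝ) : ℂ) / ζ) (((s : ℝ) : ℂ) * (1 - ((s : ℝ) : ℂ) / ζ)) s a) ζ := by
  -- The multiplier (1 - z/ζ)/(1 - z/s) vanishes at ζ.
  have h0 : ((s : ℝ) : ℂ) / ζ + ((s : ℝ) : ℂ) * (1 - ((s : ℝ) : ℂ) / ζ) / (((s : ℝ) : ℂ) - ζ) = 0 := by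
    have : ((s : ℝ) : ℂ) - ζ ≠ 0 := sub_ne_zero.2 hζs.symm
    field_simp
    ring
  refine ⟨fun t ht => ?_, fun hT'' => ?_⟩
  · have hts : t ≠ s := by
      rintro rfl
      exact hζs ht.symm
    rw [relocate_of_ne w _ _ a hts, ht, h0, mul_zero]
  · rw [transform_relocate hT ha _ _ hws has hζs fun t ht => h t ht (hT'' t ht), h0, zero_mul]

theorem exists_lt_norm_of_not_isBounded {S : Set ℂ} (hS : ¬ Bornology.IsBounded S) (R : ℝ) :
    ∃ z ∈ S, R < ‖z‖ := by
  by_contra! h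
  exact hS (isBounded_iff_forall_norm_le.2 ⟨R, h⟩)

/-! ### The inductive construction -/

theorem IsFlat.exists_vanishesAt_insert {T T' : Set ℝ} {w : ℝ → ℝ} {M : ℝ → ℝ}
    (hT : IsDiscreteSequence T) (hw : ∀ t ∈ T, 0 < w t) (hT' : T' ⊆ T) (hinf : T'.Infinite)
    (hM : IsNormalWeight M) (hMT : ∀ t ∈ T, M t = √(w t))
    (hdec : ∃ x y : ℝ, 0 < |x| ∧ |x| < |y| ∧ M y < M x)
    {C₁ : ℝ} (hC₁ : 0 < C₁) {N : ℕ}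
    (hsep : ∀ s ∈ T, ∀ t ∈ T, s ≠ t → 1 ≤ C₁ * |s| ^ N * |s - t|)
    {p : ℕ} (hp : Summable fun t : T => 1 / |(t : ℝ)| ^ p)
    {S : Set ℂ} (hS : ¬ Bornology.IsBounded S) {a : Coeff T} (ha : IsFlat T' w (3 + N + p) a)
    {W : Finset ℂ} (hW : ∀ z ∈ W, VanishesAt T' w a z) {ε : ℝ} (hε : 0 < ε) :
    ∃ b : Coeff T, ∃ ζ ∈ S, ζ ∉ W ∧ IsFlat T' w (3 + N + p) b ∧ dist a b ≤ ε ∧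
      VanishesAt T' w b ζ ∧ ∀ z ∈ W, VanishesAt T' w b z := by
  obtain ⟨C, R, hCR⟩ := ha.moments.exists_hasSum_relocate_sub_le hT hw hM hMT hdec hC₁ hsep
    (ha.summable hT hp)
  obtain ⟨R₁, hR₁⟩ := ha.vanish
  obtain ⟨R₂, hR₂⟩ := isBounded_iff_forall_norm_le.1 W.finite_toSet.isBounded
  -- Beyond R the cost estimate holds, beyond R₁ the family vanishes on T', beyond R₂ the moved zero
  -- is not one of those in W, and beyond C/ε the cost is below ε.
  obtain ⟨s', hs', hlt⟩ := hT.exists_lt_abs hT' hinf (max (max R R₁) (max R₂ (C / ε)))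
  simp only [max_lt_iff] at hlt
  obtain ⟨⟨hRs, hR₁s⟩, hR₂s, hCs⟩ := hlt
  obtain ⟨s, rfl⟩ : ∃ s : T, (s : ℝ) = s' := ⟨⟨s', hT' hs'⟩, rfl⟩
  have hws := hw s s.2
  have has : a s = 0 := hR₁ s hs' hR₁s.le
  have hspos : 0 < |(s : ℝ)| := abs_pos.2 fun h => hT.zero_notMem (h ▸ s.2)
  have hsnorm : ‖((s : ℝ) : ℂ)‖ = |(s : ℝ)| := by rw [Complex.norm_real, Real.norm_eq_abs]
  obtain ⟨ζ, hζS, hζ⟩ := exists_lt_norm_of_not_isBounded hS |(s : ℝ)|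
  obtain ⟨β, x, hx, hβ, hle⟩ := hCR s hRs.le has ζ hζ
  obtain ⟨y, hy, hynorm⟩ := exists_coeff_norm_le hβ hle
  have hb : ((a + y : Coeff T) : T → ℂ) = CauchyLocalization.relocate w (((s : ℝ) : ℂ) / ζ)
      (((s : ℝ) : ℂ) * (1 - ((s : ℝ) : ℂ) / ζ)) s a := by
    ext t
    rw [lp.coeFn_add, Pi.add_apply, hy]
    ring
  refine ⟨a + y, ζ, hζS, fun h => ?_, ?_, ?_, ?_, fun z hz => ?_⟩
  · linarith [hR₂ ζ h]
  · rw [hb]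
    exact ha.relocate hT _ _ hws has
  · rw [dist_self_add_right]
    refine (hynorm.trans hx).trans ?_
    rw [div_le_iff₀ hspos]
    rw [div_lt_iff₀ hε] at hCs
    linarith
  · rw [hb]
    refine vanishesAt_relocate hT ha.moments hws has (norm_pos_iff.1 (hspos.trans hζ)) ?_
      fun t ht htT' => hR₁ t htT' ?_
    · rintro rfl
      exact (hsnorm ▸ hζ).false
    · rw [← ht, Complex.norm_real, Real.norm_eq_abs] at hζ
      linarith
  · rw [hb]
    refine (hW z hz).relocate hT ha.moments _ _ hws has ?_
    rintro rfl
    linarith [hR₂ _ hz]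

theorem exists_infinite_setOf_vanishesAt {T T' : Set ℝ} {w : ℝ → ℝ} {M : ℝ → ℝ}
    (hT : IsDiscreteSequence T) (hsep : PowerSeparated T) (hw : IsAdmissibleWeight T w)
    (hT' : T' ⊆ T) (hinf : T'.Infinite)
    (hmem : PolynomialsInL2 ((discreteMeasure T w).restrict (T \ T')))
    (hnotdense : ¬ PolynomialsDenseInL2 ((discreteMeasure T w).restrict (T \ T')))
    (hM : IsNormalWeight M) (hMT : ∀ t ∈ T, M t = √(w t))
    {S : Set ℂ} (hS : ¬ Bornology.IsBounded S) :
    ∃ a : Coeff T, a ≠ 0 ∧ {z ∈ S | VanishesAt T' w a z}.Infinite := by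
  classical
  obtain ⟨C₁, hC₁, N, hN⟩ := hsep.exists_one_le_mul hT
  obtain ⟨p, hp⟩ := hsep.exists_summable_one_div_abs_pow hT
  obtain ⟨a₀, ha₀, ha₀T', ha₀flat⟩ := exists_isFlat_zero_of_not_dense hT hw.pos hmem hnotdense
  have hinf' : (T \ T').Infinite := by
    refine (((ha₀flat.moments.infinite_support hw.pos ha₀).image
      Subtype.val_injective.injOn)).mono ?_
    rintro _ ⟨t, ht, rfl⟩
    exact ⟨t.2, fun h => ht (ha₀T' t h)⟩
  have hdec := exists_normalWeight_lt hT hw.pos hMT hmem hinf'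
  obtain ⟨a₁, ha₁, ha₁flat⟩ := IsFlat.exists_ne_zero hT hw.pos hT' hinf ⟨a₀, ha₀, ha₀flat⟩
    (3 + N + p)
  have hsum : Summable fun t : T => ‖a₁ t‖ := by
    have : IsFlat T' w (0 + (3 + N + p)) a₁ := by rwa [zero_add]
    refine (this.summable (p := 3 + N + p) hT ?_).congr fun t => by simp
    obtain ⟨δ, hδ, hTδ⟩ := hT.exists_pos_le_abs
    refine Summable.of_nonneg_of_le (fun t => by positivity) (fun t => ?_)
      (hp.mul_left (1 / δ ^ (3 + N)))
    have := hδ.trans_le (hTδ t t.2)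
    rw [pow_add, one_div_mul_one_div]
    gcongr
    exact hTδ t t.2
  obtain ⟨α, hα, -⟩ := exists_coeff_norm_le hsum.hasSum fun t => le_rfl
  have hαa : (α : T → ℂ) = a₁ := funext hα
  have hα0 : α ≠ 0 := by
    rintro rfl
    exact ha₁ hαa.symm
  have hαpos : 0 < ‖α‖ := norm_pos_iff.2 hα0
  let State := {x : Coeff T × Finset ℂ // IsFlat T' w (3 + N + p) x.1 ∧ ↑x.2 ⊆ S ∧
    ∀ z ∈ x.2, VanishesAt T' w x.1 z}
  -- The geometric steps add up to at most ‖α‖/2, so the limit cannot be 0.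
  have hstep : ∀ n : ℕ, ∀ x : State, ∃ y : State, dist x.1.1 y.1.1 ≤ ‖α‖ / 2 / 2 / 2 ^ n ∧
      x.1.2 ⊆ y.1.2 ∧ x.1.2.card < y.1.2.card := by
    rintro n ⟨⟨a, W⟩, ha, hWS, hW⟩
    obtain ⟨b, ζ, hζS, hζW, hb, hab, hbζ, hbW⟩ := ha.exists_vanishesAt_insert hT hw.pos hT' hinf hM
      hMT hdec hC₁ hN hp hS hW (ε := ‖α‖ / 2 / 2 / 2 ^ n) (by positivity)
    refine ⟨⟨⟨b, insert ζ W⟩, hb, ?_, ?_⟩, hab, Finset.subset_insert _ _, ?_⟩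
    · rw [Finset.coe_insert]
      exact Set.insert_subset hζS hWS
    · intro z hz
      rcases Finset.mem_insert.1 hz with rfl | hz
      · exact hbζ
      · exact hbW z hz
    · simp [Finset.card_insert_of_notMem hζW]
  choose next hnext₁ hnext₂ hnext₃ using hstep
  let x : ℕ → State := fun n => Nat.rec ⟨⟨α, ∅⟩, by rw [hαa]; exact ha₁flat, by simp, by simp⟩ next n
  have hdist : ∀ n, dist (x n).1.1 (x (n + 1)).1.1 ≤ ‖α‖ / 2 / 2 / 2 ^ n := fun n =>
    hnext₁ n (x n)
  obtain ⟨a, ha⟩ := cauchySeq_tendsto_of_complete (cauchySeq_of_le_geometric_two hdist)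
  have hmono : Monotone fun n => (x n).1.2 := monotone_nat_of_le_succ fun n => hnext₂ n (x n)
  have hcard : ∀ n, n ≤ (x n).1.2.card := by
    intro n
    induction n with
    | zero => exact Nat.zero_le _
    | succ n ih => exact ih.trans_lt (hnext₃ n (x n))
  refine ⟨a, ?_, fun hfin => ?_⟩
  · rintro rfl
    have := dist_le_of_le_geometric_two_of_tendsto₀ hdist ha
    rw [dist_zero_right] at this
    change ‖α‖ ≤ ‖α‖ / 2 at this
    linarith
  · have hsub : ∀ n, (x n).1.2 ⊆ hfin.toFinset := by
      intro n z hz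
      rw [Set.Finite.mem_toFinset]
      refine ⟨(x n).2.2.1 hz, (isClosed_setOf_vanishesAt T' hT hw z).mem_of_tendsto ha ?_⟩
      filter_upwards [Filter.eventually_ge_atTop n] with m hm
      exact (x m).2.2.2 z (hmono hm hz)
    have := (hcard (hfin.toFinset.card + 1)).trans (Finset.card_le_card (hsub (hfin.toFinset.card + 1)))
    omega

/-! ### Failure of the four localization conditions -/

theorem VanishesAt.mem_zeroSet {T T' : Set ℝ} {w : ℝ → ℝ} {a : Coeff T} {z : ℂ}
    (h : VanishesAt T' w a z) : z ∈ zeroSet w a := by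
  by_cases hz : ∃ t : T, z = ((t : ℝ) : ℂ)
  · obtain ⟨t, ht⟩ := hz
    exact Or.inr ⟨t, ht, h.1 t ht.symm⟩
  · push Not at hz
    exact Or.inl ⟨hz, h.2 fun t ht => absurd ht.symm (hz t)⟩

theorem VanishesAt.mem_multipleZeroSet {T T' : Set ℝ} {w : ℝ → ℝ} {a : Coeff T} {t : T}
    (ht : (t : ℝ) ∈ T') (h : VanishesAt T' w a ((t : ℝ) : ℂ)) :
    ((t : ℝ) : ℂ) ∈ multipleZeroSet w a := by
  refine Or.inr ⟨t, rfl, h.1 t rfl, h.2 fun s hs => ?_⟩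
  rw [Complex.ofReal_inj] at hs
  rwa [hs]

theorem not_isBounded_of_forall_mul_I_mem {S : Set ℂ} {R : ℝ}
    (h : ∀ y : ℝ, R ≤ y → (y : ℂ) * Complex.I ∈ S) : ¬ Bornology.IsBounded S := by
  intro hb
  obtain ⟨C, hC⟩ := isBounded_iff_forall_norm_le.1 hb
  have h1 := hC _ (h (max R (|C| + 1)) (le_max_left _ _))
  rw [norm_mul, Complex.norm_I, mul_one, Complex.norm_real, Real.norm_eq_abs] at h1
  linarith [le_abs_self (max R (|C| + 1)), le_max_right R (|C| + 1), le_abs_self C]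

theorem abs_le_norm_mul_I_sub (y t : ℝ) : |y| ≤ ‖(y : ℂ) * Complex.I - t‖ ∧
    |t| ≤ ‖(y : ℂ) * Complex.I - t‖ := by
  constructor
  · simpa using Complex.abs_im_le_norm ((y : ℂ) * Complex.I - t)
  · simpa using Complex.abs_re_le_norm ((y : ℂ) * Complex.I - t)

/-- A disc centred on the real line that contains iy also contains 0. By disjointness only one disc
can do so, and it is bounded. -/
theorem exists_forall_mul_I_notMem_ball {T : Set ℝ} {r : T → ℝ}
    (hr : Pairwise fun s t : T =>
      Disjoint (Metric.ball ((s : ℝ) : ℂ) (r s)) (Metric.ball ((t : ℝ) : ℂ) (r t))) :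
    ∃ R : ℝ, ∀ y : ℝ, R ≤ y → ∀ t : T, (y : ℂ) * Complex.I ∉ Metric.ball ((t : ℝ) : ℂ) (r t) := by
  have hzero : ∀ (y : ℝ) (t : T), (y : ℂ) * Complex.I ∈ Metric.ball ((t : ℝ) : ℂ) (r t) →
      (0 : ℂ) ∈ Metric.ball ((t : ℝ) : ℂ) (r t) := by
    intro y t h
    rw [mem_ball_iff_norm] at h ⊢
    rw [zero_sub, norm_neg, Complex.norm_real, Real.norm_eq_abs]
    exact (abs_le_norm_mul_I_sub y t).2.trans_lt h
  by_cases h : ∃ t : T, (0 : ℂ) ∈ Metric.ball ((t : ℝ) : ℂ) (r t)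
  · obtain ⟨t₀, ht₀⟩ := h
    refine ⟨r t₀, fun y hy t ht => ?_⟩
    have htt : t = t₀ := by
      by_contra hne
      exact Set.disjoint_left.1 (hr hne) (hzero y t ht) ht₀
    rw [htt, mem_ball_iff_norm] at ht
    linarith [(abs_le_norm_mul_I_sub y t₀).1, le_abs_self y]
  · exact ⟨0, fun y _ t ht => h ⟨t, hzero y t ht⟩⟩

end CauchyLocalization

theorem mainTheorem9 (T : Set ℝ) (w : ℝ → ℝ)
    (hT : CauchyLocalization.IsDiscreteSequence T)
    (hsep : CauchyLocalization.PowerSeparated T)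
    (hw : CauchyLocalization.IsAdmissibleWeight T w)
    (T' : Set ℝ) (hT' : T' ⊆ T) (hT'inf : T'.Infinite)
    (hmem : CauchyLocalization.PolynomialsInL2
      ((CauchyLocalization.discreteMeasure T w).restrict (T \ T')))
    (hnotdense : ¬ CauchyLocalization.PolynomialsDenseInL2
      ((CauchyLocalization.discreteMeasure T w).restrict (T \ T')))
    (M : ℝ → ℝ) (hM : CauchyLocalization.IsNormalWeight M)
    (hMT : ∀ t ∈ T, M t = √(w t)) :
    ¬ CauchyLocalization.HasLocalizationProperty T w := by
  open CauchyLocalization in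
  have key := fun (S : Set ℂ) (hS : ¬ Bornology.IsBounded S) =>
    exists_infinite_setOf_vanishesAt hT hsep hw hT' hT'inf hmem hnotdense hM hMT hS
  rintro (⟨S, hS, hloc⟩ | hloc | ⟨r, -, hr, hloc⟩ | hloc)
  · obtain ⟨a, ha, hinf⟩ := key S hS
    exact hinf ((hloc a ha).subset fun z hz => ⟨hz.2.mem_zeroSet, hz.1⟩)
  · obtain ⟨a, ha, hinf⟩ := key {z | ∀ t : T, z ∉ Metric.ball ((t : ℝ) : ℂ) 1}
      (not_isBounded_of_forall_mul_I_mem (R := 1) fun y hy t ht => by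
        rw [mem_ball_iff_norm] at ht
        linarith [(abs_le_norm_mul_I_sub y t).1, le_abs_self y])
    refine hinf ((hloc a ha).subset fun z hz => ⟨hz.2.mem_zeroSet, fun h => ?_⟩)
    obtain ⟨t, ht⟩ := Set.mem_iUnion.1 h
    exact hz.1 t ht
  · obtain ⟨R, hR⟩ := exists_forall_mul_I_notMem_ball hr
    obtain ⟨a, ha, hinf⟩ := key {z | ∀ t : T, z ∉ Metric.ball ((t : ℝ) : ℂ) (r t)}
      (not_isBounded_of_forall_mul_I_mem hR)
    refine hinf ((hloc a ha).1.subset fun z hz => ⟨hz.2.mem_zeroSet, fun h => ?_⟩)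
    obtain ⟨t, ht⟩ := Set.mem_iUnion.1 h
    exact hz.1 t ht
  -- With S = T' every prescribed zero is a point t where both a_t and the extension of f vanish,
  -- hence a multiple zero.
  · obtain ⟨a, ha, hinf⟩ := key ((fun t : ℝ => (t : ℂ)) '' T') fun hb => by
      obtain ⟨C, hC⟩ := isBounded_iff_forall_norm_le.1 hb
      obtain ⟨t, ht, hlt⟩ := hT.exists_lt_abs hT' hT'inf C
      have := hC _ ⟨t, ht, rfl⟩
      rw [Complex.norm_real, Real.norm_eq_abs] at this
      linarith
    refine hinf ((hloc a ha).subset ?_)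
    rintro _ ⟨⟨t, ht, rfl⟩, h⟩
    exact VanishesAt.mem_multipleZeroSet (t := ⟨t, hT' ht⟩) ht h
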